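/- Let $\ell$ be a prime number, $d\ge 0$ and $n_0\ge 1$ integers, and $L$ a free pro-$\ell$ group with free topological generators $x_1,\dots,x_d$. Let $L^{[1]}=L$ and let $L^{[n+1]}$ be the closed subgroup of $L$ generated by the $\ell$-th powers of elements of $L^{[n]}$ and the commutators of elements of $L^{[n]}$ with elements of $L$; put $L^{(n)}=L/L^{[n]}$. Let $\Lambda$ be a finite commutative ring whose order is a power of $\ell$, and let $V$ be a finitely generated $\Lambda$-module with a $\Lambda$-linear action of $L^{(n_0)}$; for $n\ge n_0$, $L^{(n)}$ acts on $V$ through the projection $L^{(n)}\to L^{(n_0)}$. Suppose that the action is given explicitly, that is, by the following finite data $c$: the integers $\ell$, $d$, $n_0$; the addition and multiplication tables of $\Lambda$ (for some numbering of its elements); a finite presentation $V=\operatorname{Coker}(\Lambda^m\to\Lambda^r)$ by a matrix with entries in $\Lambda$; and, for each $s=1,\dots,d$, a matrix $\Lambda^r\to\Lambda^r$ inducing on $V$ the automorphism by which the class of $x_s$ acts. An inductive system $(A_n)_{n\ge n_0}$ of $\Lambda$-modules is called $(N,\varphi)$-essentially constant, where $N\ge n_0$ is an integer and $\varphi$ is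 a function with $\varphi(j)\ge j$ for all $j\ge n_0$, if 1. $\operatorname{Ker}(A_j\to A_{\varphi(j)})=\operatorname{Ker}(A_j\to A_k)$ for all $j\ge n_0$ and $k\ge\varphi(j)$; 2. $\operatorname{Im}(A_N\to A_{\varphi(j)})=\operatorname{Im}(A_j\to A_{\varphi(j)})$ for all $j\ge N$. Then for every integer $i\ge 0$ the inductive system $H^i(L^{(n)},V)$, $n\ge n_0$, with the inflation maps as transition maps, is explicitly essentially constant: there are computable (general recursive) functions $(c,i)\mapsto N(c,i)$ and $(c,i,j)\mapsto\varphi(c,i,j)$ such that, for all data $c$ describing $L$, $\Lambda$, $V$ and the action as above and for all $i$, the system $\big(H^i(L^{(n)},V)\big)_{n\ge n_0}$ is $\big(N(c,i),\varphi(c,i,\cdot)\big)$-essentially constant. -/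

import Mathlib

open CategoryTheory

universe u

/-! ### Pro-ℓ groups and free pro-ℓ groups -/

/-- A pro-`ℓ` group: a profinite group all of whose open normal subgroups have index a power
of `ℓ`. -/
structure IsProEll (ℓ : ℕ) (G : Type u) [Group G] [TopologicalSpace G] : Prop where
  isTopologicalGroup : IsTopologicalGroup G
  compactSpace : CompactSpace G
  totallyDisconnectedSpace : TotallyDisconnectedSpace G
  index_eq_pow : ∀ U : Subgroup G, U.Normal → IsOpen (U : Set G) → ∃ k : ℕ, U.index = ℓ ^ k

/-- `L` is a free pro-`ℓ` group, freely generated as such by `x₁, …, x_d`: every family of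
`d` elements of a pro-`ℓ` group is the image of `(x₁, …, x_d)` under exactly one continuous
homomorphism. -/
structure IsFreeProEll (ℓ : ℕ) {d : ℕ} (L : Type u) [Group L] [TopologicalSpace L]
    (x : Fin d → L) : Prop where
  isProEll : IsProEll ℓ L
  existsUnique_lift : ∀ (G : Type u) [Group G] [TopologicalSpace G], IsProEll ℓ G →
    ∀ g : Fin d → G, ∃! f : L →ₜ* G, ∀ s, f (x s) = g s

/-! ### The descending ℓ-central series -/

section EllCentral

variable (ℓ : ℕ) (G : Type u) [Group G] [TopologicalSpace G] [IsTopologicalGroup G]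

/-- The descending `ℓ`-central series, numbered from `1`: `G^[1] = G`, and `G^[n+1]` is the closed
subgroup generated by the `ℓ`-th powers of elements of `G^[n]` and by the commutators of elements
of `G^[n]` with elements of `G`. (The value at `0` is a convention, and is not used.) -/
def ellCentral : ℕ → Subgroup G
  | 0 => ⊤
  | 1 => ⊤
  | n + 2 =>
    (Subgroup.closure ((fun h : G => h ^ ℓ) '' (ellCentral (n + 1) : Set G)) ⊔
      ⁅ellCentral (n + 1), (⊤ : Subgroup G)⁆).topologicalClosure

theorem normal_closure_pow_image {G : Type u} [Group G] (ℓ : ℕ) (H : Subgroup G) (hH : H.Normal) :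
    (Subgroup.closure ((fun h : G => h ^ ℓ) '' (H : Set G))).Normal := by
  constructor
  intro y hy g
  induction hy using Subgroup.closure_induction with
  | mem y hy =>
    obtain ⟨h, hh, rfl⟩ := hy
    refine Subgroup.subset_closure ⟨g * h * g⁻¹, hH.conj_mem h hh g, ?_⟩
    simp [conj_pow]
  | one => simp
  | mul a b _ _ ha hb =>
    have : g * (a * b) * g⁻¹ = (g * a * g⁻¹) * (g * b * g⁻¹) := by group
    rw [this]
    exact Subgroup.mul_mem _ ha hb
  | inv a _ ha =>
    have : g * a⁻¹ * g⁻¹ = (g * a * g⁻¹)⁻¹ := by group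
    rw [this]
    exact Subgroup.inv_mem _ ha

instance ellCentral_normal (n : ℕ) : (ellCentral ℓ G n).Normal := by
  match n with
  | 0 => exact (inferInstance : (⊤ : Subgroup G).Normal)
  | 1 => exact (inferInstance : (⊤ : Subgroup G).Normal)
  | n + 2 =>
    have h1 := ellCentral_normal (n + 1)
    have h2 := normal_closure_pow_image ℓ _ h1
    exact Subgroup.is_normal_topologicalClosure _

theorem ellCentral_isClosed (n : ℕ) : IsClosed (ellCentral ℓ G n : Set G) := by
  match n with
  | 0 => exact isClosed_univ
  | 1 => exact isClosed_univ
  | n + 2 => exact Subgroup.isClosed_topologicalClosure _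

theorem ellCentral_succ_le (n : ℕ) : ellCentral ℓ G (n + 1) ≤ ellCentral ℓ G n := by
  match n with
  | 0 => exact le_top
  | n + 1 =>
    refine Subgroup.topologicalClosure_minimal _ (sup_le ?_ ?_) (ellCentral_isClosed ℓ G (n + 1))
    · rw [Subgroup.closure_le]
      rintro _ ⟨h, hh, rfl⟩
      exact Subgroup.pow_mem _ hh ℓ
    · exact Subgroup.commutator_le_left _ _

theorem ellCentral_antitone : Antitone (ellCentral ℓ G) :=
  antitone_nat_of_succ_le (ellCentral_succ_le ℓ G)

/-- The quotient `G^(n) = G / G^[n]`. -/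
abbrev EllQuotient (n : ℕ) : Type u := G ⧸ ellCentral ℓ G n

/-- The projection `G^(m) → G^(n)`, for `n ≤ m`. -/
def ellProj {n m : ℕ} (h : n ≤ m) : EllQuotient ℓ G m →* EllQuotient ℓ G n :=
  QuotientGroup.map _ _ (MonoidHom.id G) (ellCentral_antitone ℓ G h)

theorem ellProj_self (n : ℕ) : ellProj ℓ G (le_refl n) = MonoidHom.id _ := by
  ext x
  rfl

theorem ellProj_comp {n m k : ℕ} (h : n ≤ m) (h' : m ≤ k) :
    (ellProj ℓ G h).comp (ellProj ℓ G h') = ellProj ℓ G (h.trans h') := by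
  ext x
  rfl

end EllCentral

/-! ### The inductive system of cohomology groups -/

section System

variable {ℓ : ℕ} {L : Type u} [Group L] [TopologicalSpace L] [IsTopologicalGroup L]
  {Λ : Type u} [CommRing Λ] {V : Type u} [AddCommGroup V] [Module Λ V]

/-- For `n ≥ n₀`, the `Λ`-module `V` with the action of `L^(n)` deduced from the action `ρ` of
`L^(n₀)` through the projection `L^(n) → L^(n₀)`. -/
noncomputable abbrev inflated {n₀ : ℕ} (ρ : Representation Λ (EllQuotient ℓ L n₀) V)
    (n : Set.Ici n₀) : Rep.{u} Λ (EllQuotient ℓ L n.1) :=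
  Rep.res (ellProj ℓ L n.2) (Rep.of ρ)

/-- The identity of `V`, seen as a map of representations of `L^(m)` from the restriction of
`inflated ρ n` to `inflated ρ m`, for `n ≤ m`. -/
noncomputable def inflatedId {n₀ : ℕ} (ρ : Representation Λ (EllQuotient ℓ L n₀) V)
    {n m : Set.Ici n₀} (h : n ≤ m) :
    Rep.res (ellProj ℓ L (show n.1 ≤ m.1 from h)) (inflated ρ n) ⟶ inflated ρ m :=
  Rep.ofHom ⟨LinearMap.id, fun g => by
    have := DFunLike.congr_fun (ellProj_comp ℓ L n.2 (show n.1 ≤ m.1 from h)) g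
    ext v
    exact congrArg (fun y => ρ y v) this⟩

/-- The inductive system `n ↦ H^i(L^(n), V)`, `n ≥ n₀`, with the inflation maps as transition
maps. -/
noncomputable def cohomologySystem {n₀ : ℕ} (ρ : Representation Λ (EllQuotient ℓ L n₀) V)
    (i : ℕ) : Set.Ici n₀ ⥤ ModuleCat.{u} Λ where
  obj n := groupCohomology (inflated ρ n) i
  map {n m} f := groupCohomology.map (ellProj ℓ L (show n.1 ≤ m.1 from leOfHom f))
    (inflatedId ρ (leOfHom f)) i
  map_id n := by
    rw [← groupCohomology.map_id]
    exact groupCohomology.map_congr (ellProj_self ℓ L n.1) rfl i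
  map_comp {n m k} f g := by
    rw [← groupCohomology.map_comp]
    exact groupCohomology.map_congr (ellProj_comp ℓ L _ _).symm rfl i

end System

/-! ### Essentially constant systems -/

section EssentiallyConstant

variable {R : Type u} [Ring R] {i₀ : ℕ}

/-- The transition map `A_j → A_k` of an inductive system indexed by the integers `≥ i₀`. -/
def transition (A : Set.Ici i₀ ⥤ ModuleCat.{u} R) {j k : ℕ} (hj : i₀ ≤ j) (hjk : j ≤ k) :
    A.obj ⟨j, hj⟩ →ₗ[R] A.obj ⟨k, hj.trans hjk⟩ :=
  (A.map (homOfLE (show (⟨j, hj⟩ : Set.Ici i₀) ≤ ⟨k, hj.trans hjk⟩ from hjk))).hom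

/-- `(N, φ)`-essentially constant inductive systems: `N ≥ i₀`, `φ(j) ≥ j` for all `j ≥ i₀`, and
(i) `Ker(A_j → A_φ(j)) = Ker(A_j → A_k)` for all `j ≥ i₀` and `k ≥ φ(j)`;
(ii) `Im(A_N → A_φ(j)) = Im(A_j → A_φ(j))` for all `j ≥ N`. -/
structure IsEssentiallyConstant (A : Set.Ici i₀ ⥤ ModuleCat.{u} R) (N : ℕ) (φ : ℕ → ℕ) :
    Prop where
  le_N : i₀ ≤ N
  le_phi : ∀ j, i₀ ≤ j → j ≤ φ j
  ker_eq : ∀ j k (hj : i₀ ≤ j) (hk : φ j ≤ k),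
    LinearMap.ker (transition A hj (le_phi j hj)) =
      LinearMap.ker (transition A hj ((le_phi j hj).trans hk))
  range_eq : ∀ j (hj : N ≤ j),
    LinearMap.range (transition A le_N (hj.trans (le_phi j (le_N.trans hj)))) =
      LinearMap.range (transition A (le_N.trans hj) (le_phi j (le_N.trans hj)))

end EssentiallyConstant

/-! ### Explicit actions -/

/-- The finite data by which an action of `L^(n₀)` on a finite `Λ`-module `V` is given to an
algorithm. All entries are natural numbers; the elements of `Λ` are numbered from `0` to
`card - 1`. -/
structure ExplicitAction where
  /-- the prime number `ℓ` -/
  prime : ℕ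
  /-- the number `d` of generators of the free pro-`ℓ` group `L` -/
  rank : ℕ
  /-- the integer `n₀` -/
  level : ℕ
  /-- the number of elements of `Λ` -/
  card : ℕ
  /-- the addition table of `Λ` -/
  addTable : List (List ℕ)
  /-- the multiplication table of `Λ` -/
  mulTable : List (List ℕ)
  /-- the number of generators in the presentation of `V` -/
  gens : ℕ
  /-- the number of relations in the presentation of `V` -/
  rels : ℕ
  /-- the matrix of relations: entry `(a, b)` is the coefficient of the `a`-th generator in the
  `b`-th relation -/
  relMatrix : List (List ℕ)
  /-- `d` matrices: the `s`-th one lifts to the free module on the generators the automorphism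
  by which the `s`-th generator of `L` acts on `V` -/
  actMatrices : List (List (List ℕ))

namespace ExplicitAction

/-- An explicit action is a tuple of numbers and lists. -/
def equivTuple : ExplicitAction ≃
    (ℕ × ℕ × ℕ × ℕ × List (List ℕ) × List (List ℕ) × ℕ × ℕ × List (List ℕ) ×
      List (List (List ℕ))) where
  toFun c := (c.prime, c.rank, c.level, c.card, c.addTable, c.mulTable, c.gens, c.rels,
    c.relMatrix, c.actMatrices)
  invFun t := ⟨t.1, t.2.1, t.2.2.1, t.2.2.2.1, t.2.2.2.2.1, t.2.2.2.2.2.1, t.2.2.2.2.2.2.1,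
    t.2.2.2.2.2.2.2.1, t.2.2.2.2.2.2.2.2.1, t.2.2.2.2.2.2.2.2.2⟩
  left_inv _ := rfl
  right_inv _ := rfl

/-- Computability of functions of an explicit action is computability in the corresponding tuple
of numbers and lists, for the standard codings. -/
instance : Primcodable ExplicitAction := Primcodable.ofEquiv _ equivTuple

/-- The entry in row `a` and column `b` of a table of natural numbers. -/
def entry (T : List (List ℕ)) (a b : ℕ) : ℕ := (T.getD a []).getD b 0

/-- `c.Describes x ρ`: the data `c` describe the ring `Λ`, the `Λ`-module `V` and the action `ρ`
of `L^(n₀)` on `V`, with respect to the topological generators `x₁, …, x_d` of `L`: after a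
numbering of `Λ`, the tables of `c` are those of `Λ`; the module `V` is the cokernel of the matrix
of relations; and the action of the class of `x_s` on `V` is induced by the `s`-th matrix. -/
structure Describes (c : ExplicitAction) {L : Type u} [Group L] [TopologicalSpace L]
    [IsTopologicalGroup L] (x : Fin c.rank → L)
    {Λ : Type u} [CommRing Λ] {V : Type u} [AddCommGroup V] [Module Λ V]
    (ρ : Representation Λ (EllQuotient c.prime L c.level) V) where
  /-- the numbering of `Λ` -/
  num : Λ ≃ Fin c.card
  addTable_eq : ∀ a b : Λ, entry c.addTable (num a) (num b) = num (a + b)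
  mulTable_eq : ∀ a b : Λ, entry c.mulTable (num a) (num b) = num (a * b)
  /-- the matrix of relations, with coefficients in `Λ` -/
  relMatrix : Matrix (Fin c.gens) (Fin c.rels) Λ
  relMatrix_eq : ∀ (a : Fin c.gens) (b : Fin c.rels), entry c.relMatrix a b = num (relMatrix a b)
  /-- the map from the free module on the generators onto `V` -/
  proj : (Fin c.gens → Λ) →ₗ[Λ] V
  proj_surjective : Function.Surjective proj
  ker_proj : LinearMap.ker proj = LinearMap.range relMatrix.mulVecLin
  /-- the matrices of the action, with coefficients in `Λ` -/
  actMatrix : Fin c.rank → Matrix (Fin c.gens) (Fin c.gens) Λ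
  actMatrix_eq : ∀ (s : Fin c.rank) (a b : Fin c.gens),
    entry (c.actMatrices.getD s []) a b = num (actMatrix s a b)
  act_eq : ∀ (s : Fin c.rank) (v : Fin c.gens → Λ), proj ((actMatrix s).mulVec v) =
    ρ (QuotientGroup.mk (x s) : EllQuotient c.prime L c.level) (proj v)

end ExplicitAction

open scoped commutatorElement

/-! ### Free pro-`ℓ` groups and their finite quotients -/

section FreeProEll

/-! A free pro-`ℓ` group has cohomological dimension at most one; the proof makes this effective,
using only orders of finite groups.

Any finite `ℓ`-group receives a homomorphism from `L` with prescribed values on the generators, and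
one into a group of order `ℓ ^ e` kills `L^[e+1]` (`ellCentral_le_ker`). Applied to a semidirect
product of coefficients `M` with `L^(j)`, this gives over a level `k ≥ |M|·|L^(j)|` a 1-cocycle with
prescribed values on the generators (`exists_cocycle`); those values determine it (`cocycle_ext`).

In degrees 0 and 1 inflation is injective. It is surjective from level `|V|·|L^(n₀)|` on, because a
1-cocycle at a deeper level has the same values on the generators as one defined there.

In degrees at least 2 inflation from `j` to a suitable `k` is zero. Put `G = L^(j)` and embed `V` in
the functions `G → V`. A cocycle `f` becomes a coboundary `dg` there, and `g` modulo `V` is a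
cocycle of one degree less. If over `L^(k)` it lifts to a cocycle `h` with values in the functions,
then `g - h` takes values in `V` and has coboundary `f`. Such an `h` comes from `exists_cocycle` if
`g` has degree 1, and otherwise from induction on the degree (`exists_coboundary_eq`).

The levels depend only on bounds for `|V|`, which divides `|Λ|` to the number of generators, and for
`|L^(n)|` (`ellQuotient_finite`). These bounds are primitive recursive in the data. -/

theorem MonoidHom.continuous_of_isOpen_ker {G H : Type*} [Group G] [TopologicalSpace G]
    [IsTopologicalGroup G] [Group H] [TopologicalSpace H] [IsTopologicalGroup H]
    (f : G →* H) (hf : IsOpen (f.ker : Set G)) : Continuous f := by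
  refine continuous_of_continuousAt_one f ?_
  have h : ∀ᶠ y in nhds (1 : G), f y = f 1 := by
    filter_upwards [hf.mem_nhds f.ker.one_mem] with y hy
    rw [map_one]
    exact hy
  exact (tendsto_const_nhds (x := f 1)).congr' (h.mono fun y hy => hy.symm)

theorem isProEll_of_finite {ℓ a : ℕ} (hℓ : ℓ.Prime) {F : Type u} [Group F] [TopologicalSpace F]
    [DiscreteTopology F] (hF : Nat.card F = ℓ ^ a) : IsProEll ℓ F := by
  have : Finite F := Nat.finite_of_card_ne_zero (by rw [hF]; exact pow_ne_zero _ hℓ.ne_zero)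
  refine ⟨inferInstance, inferInstance, inferInstance, fun U _ _ => ?_⟩
  have h := U.index_dvd_card
  rw [hF, Nat.dvd_prime_pow hℓ] at h
  obtain ⟨k, -, hk⟩ := h
  exact ⟨k, hk⟩

variable {ℓ d : ℕ} {L : Type u} [Group L] [TopologicalSpace L] {x : Fin d → L}

/-- With `F` discrete, continuity amounts to having an open kernel. Stated this way, the existence
half of the universal property requires no topology on `F`; `hom_ext` is the uniqueness half. -/
theorem IsFreeProEll.exists_hom (hL : IsFreeProEll ℓ L x) (hℓ : ℓ.Prime) {F : Type u} [Group F]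
    {a : ℕ} (hF : Nat.card F = ℓ ^ a) (g : Fin d → F) :
    ∃ f : L →* F, IsOpen (f.ker : Set L) ∧ ∀ s, f (x s) = g s := by
  let : TopologicalSpace F := ⊥
  have : DiscreteTopology F := ⟨rfl⟩
  obtain ⟨f, hf, -⟩ := hL.existsUnique_lift F (isProEll_of_finite hℓ hF) g
  refine ⟨f, ?_, hf⟩
  exact (isOpen_discrete ({1} : Set F)).preimage f.continuous_toFun

theorem IsProEll.card_quotient (hL : IsProEll ℓ L) (U : Subgroup L) [hU : U.Normal]
    (ho : IsOpen (U : Set L)) : ∃ k, Nat.card (L ⧸ U) = ℓ ^ k :=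
  hL.index_eq_pow U hU ho

variable [IsTopologicalGroup L]

theorem IsFreeProEll.hom_ext (hL : IsFreeProEll ℓ L x) (hℓ : ℓ.Prime) {F : Type u} [Group F]
    {a : ℕ} (hF : Nat.card F = ℓ ^ a) {f f' : L →* F} (hf : IsOpen (f.ker : Set L))
    (hf' : IsOpen (f'.ker : Set L)) (h : ∀ s, f (x s) = f' (x s)) : f = f' := by
  let : TopologicalSpace F := ⊥
  have : DiscreteTopology F := ⟨rfl⟩
  have hu := (hL.existsUnique_lift F (isProEll_of_finite hℓ hF) fun s => f (x s)).unique
    (y₁ := ⟨f, f.continuous_of_isOpen_ker hf⟩) (y₂ := ⟨f', f'.continuous_of_isOpen_ker hf'⟩)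
    (fun s => rfl) (fun s => (h s).symm)
  ext y
  exact DFunLike.congr_fun hu y

theorem QuotientGroup.isOpen_ker_mk' {G : Type*} [Group G] [TopologicalSpace G] (U : Subgroup G)
    [U.Normal] (ho : IsOpen (U : Set G)) : IsOpen ((QuotientGroup.mk' U).ker : Set G) := by
  rwa [QuotientGroup.ker_mk']

/-- The generators generate every quotient by an open normal subgroup. -/
theorem IsFreeProEll.closure_eq_top_of_isOpen (hL : IsFreeProEll ℓ L x) (hℓ : ℓ.Prime)
    (U : Subgroup L) [U.Normal] (ho : IsOpen (U : Set L)) (P : Subgroup (L ⧸ U))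
    (hP : ∀ s, (QuotientGroup.mk (x s) : L ⧸ U) ∈ P) : P = ⊤ := by
  obtain ⟨k, hk⟩ := hL.isProEll.card_quotient U ho
  have hcard := P.card_subgroup_dvd_card
  rw [hk, Nat.dvd_prime_pow hℓ] at hcard
  obtain ⟨a, -, ha⟩ := hcard
  -- The universal property is applied to `P` itself: by uniqueness the projection `L → L ⧸ U`
  -- factors through `P`.
  obtain ⟨f, hfo, hf⟩ := hL.exists_hom hℓ (F := P) ha fun s => ⟨_, hP s⟩
  have hker : (P.subtype.comp f).ker = f.ker := by
    ext y
    simp [MonoidHom.mem_ker]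
  have heq : P.subtype.comp f = QuotientGroup.mk' U :=
    hL.hom_ext hℓ hk (by rwa [hker]) (QuotientGroup.isOpen_ker_mk' U ho)
      (fun s => by simp [hf])
  rw [eq_top_iff]
  intro y _
  obtain ⟨z, rfl⟩ := QuotientGroup.mk'_surjective U y
  rw [← heq]
  exact (f z).2

/-- The generators generate a free pro-`ℓ` group topologically. -/
theorem IsFreeProEll.eq_top_of_isClosed (hL : IsFreeProEll ℓ L x) (hℓ : ℓ.Prime)
    (H : Subgroup L) (hH : IsClosed (H : Set L)) (hx : ∀ s, x s ∈ H) : H = ⊤ := by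
  have := hL.isProEll.compactSpace
  have := hL.isProEll.totallyDisconnectedSpace
  by_contra hne
  obtain ⟨y, hy⟩ : ∃ y, y ∉ H := by
    by_contra! h
    exact hne (eq_top_iff.2 fun z _ => h z)
  -- Some coset `yU` misses `H`, although `H` surjects onto `L ⧸ U`.
  have hopen : IsOpen ((fun z => y * z) ⁻¹' (H : Set L)ᶜ) :=
    hH.isOpen_compl.preimage (continuous_const_mul y)
  obtain ⟨U, hU⟩ := ProfiniteGrp.exist_openNormalSubgroup_sub_open_nhds_of_one hopen (by simpa using hy)
  have htop := hL.closure_eq_top_of_isOpen hℓ U.toSubgroup U.isOpen'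
    (H.map (QuotientGroup.mk' U.toSubgroup)) fun s => ⟨x s, hx s, rfl⟩
  have hmem : (QuotientGroup.mk y : L ⧸ U.toSubgroup) ∈ H.map (QuotientGroup.mk' U.toSubgroup) :=
    htop ▸ Subgroup.mem_top _
  obtain ⟨h, hh, hhy⟩ := hmem
  have h1 : y⁻¹ * h ∈ U.toSubgroup := QuotientGroup.eq.1 hhy.symm
  exact hU h1 (by simpa using hh)

end FreeProEll

/-! ### The quotients of the descending `ℓ`-central series -/

/-- A bound for the order of `L^(n)`, for `L` a free pro-`ℓ` group on `d` generators. -/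
def ellBound (ℓ d : ℕ) : ℕ → ℕ
  | 0 => 1
  | n + 1 => ellBound ℓ d n * ℓ ^ (d * ellBound ℓ d n)

theorem ellBound_pos {ℓ : ℕ} (hℓ : 0 < ℓ) (d n : ℕ) : 0 < ellBound ℓ d n := by
  induction n with
  | zero => exact Nat.one_pos
  | succ n ih => exact Nat.mul_pos ih (Nat.pow_pos hℓ)

/-- A finitely generated group with a central subgroup of finite index and finite exponent. -/
theorem finite_of_central_ker {G Q : Type*} [Group G] [Group Q] [Finite Q] {n : ℕ} (hn : 0 < n)
    (f : G →* Q) (hcomm : ∀ k ∈ f.ker, ∀ g : G, k * g = g * k) (hexp : ∀ k ∈ f.ker, k ^ n = 1)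
    {d : ℕ} (x : Fin d → G) (hx : Subgroup.closure (Set.range x) = ⊤) :
    Finite G ∧ Nat.card G ≤ Nat.card Q * n ^ (d * Nat.card Q) := by
  classical
  have hindex : f.ker.index ≤ Nat.card Q := by
    rw [Subgroup.index_ker]
    exact Nat.card_le_card_of_injective _ Subtype.val_injective
  have : f.ker.FiniteIndex := inferInstance
  let S : Finset G := Finset.univ.image x
  have hS : Subgroup.closure (S : Set G) = ⊤ := by simpa [S] using hx
  have hScard : S.card ≤ d := by simpa using Finset.card_image_le (s := Finset.univ) (f := x)
  -- Schreier's bound: the kernel has at most index times `d` generators. Being abelian and killed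
  -- by `n`, it has order dividing `n` to the number of generators.
  obtain ⟨T, hTcard, hT⟩ := Subgroup.exists_finset_card_le_mul f.ker hS
  let : CommGroup f.ker := { (inferInstance : Group f.ker) with
    mul_comm := fun a b => Subtype.ext (hcomm a a.2 b) }
  have : Group.FG f.ker := ⟨⟨T, hT⟩⟩
  have hrank : Group.rank f.ker ≤ d * Nat.card Q :=
    (Group.rank_le hT).trans (hTcard.trans ((Nat.mul_le_mul hindex hScard).trans_eq
      (Nat.mul_comm _ _)))
  have hdvd : Nat.card f.ker ∣ n ^ Group.rank f.ker :=
    card_dvd_exponent_pow_rank' f.ker fun k => Subtype.ext (hexp k k.2)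
  have hle : Nat.card f.ker ≤ n ^ (d * Nat.card Q) :=
    (Nat.le_of_dvd (Nat.pow_pos hn) hdvd).trans (Nat.pow_le_pow_right hn hrank)
  have hne : Nat.card f.ker ≠ 0 := fun h0 => by
    rw [h0, zero_dvd_iff] at hdvd
    exact (Nat.pow_pos hn).ne' hdvd
  have hprod := f.ker.card_mul_index
  refine ⟨Nat.finite_of_card_ne_zero ?_, ?_⟩
  · rw [← hprod]
    exact Nat.mul_ne_zero hne Subgroup.FiniteIndex.index_ne_zero
  · rw [← hprod, Nat.mul_comm]
    exact Nat.mul_le_mul hindex hle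

section Quotients

variable {ℓ d : ℕ} {L : Type u} [Group L] [TopologicalSpace L] [IsTopologicalGroup L]
  {x : Fin d → L}

theorem pow_mem_ellCentral {n : ℕ} {h : L} (hh : h ∈ ellCentral ℓ L (n + 1)) :
    h ^ ℓ ∈ ellCentral ℓ L (n + 2) :=
  Subgroup.le_topologicalClosure _
    (Subgroup.mem_sup_left (Subgroup.subset_closure ⟨h, hh, rfl⟩))

theorem commutator_mem_ellCentral {n : ℕ} {h : L} (hh : h ∈ ellCentral ℓ L (n + 1)) (g : L) :
    ⁅h, g⁆ ∈ ellCentral ℓ L (n + 2) :=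
  Subgroup.le_topologicalClosure _
    (Subgroup.mem_sup_right (Subgroup.commutator_mem_commutator hh (Subgroup.mem_top g)))

theorem mem_ellCentral_of_ellProj_eq_one {n m : ℕ} (h : n ≤ m) {y : L}
    (hy : ellProj ℓ L h (QuotientGroup.mk y) = 1) : y ∈ ellCentral ℓ L n :=
  (QuotientGroup.eq_one_iff y).1 hy

theorem ellProj_surjective {n m : ℕ} (h : n ≤ m) : Function.Surjective (ellProj ℓ L h) := by
  intro y
  obtain ⟨z, rfl⟩ := QuotientGroup.mk_surjective y
  exact ⟨QuotientGroup.mk z, rfl⟩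

/-- `L^(n+2)` is an extension of `L^(n+1)` by a central subgroup killed by `ℓ`, so
`finite_of_central_ker` gives the recursion defining `ellBound`, once finite generation is known. -/
theorem IsFreeProEll.ellQuotient_finite (hL : IsFreeProEll ℓ L x) (hℓ : ℓ.Prime) (n : ℕ) :
    Finite (EllQuotient ℓ L n) ∧ Nat.card (EllQuotient ℓ L n) ≤ ellBound ℓ d n := by
  induction n using Nat.strong_induction_on with
  | _ n ih =>
    match n with
    | 0 | 1 =>
      have hs := QuotientGroup.subsingleton_quotient_top (G := L)
      refine ⟨@Finite.of_subsingleton _ hs, ?_⟩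
      exact (@Finite.card_le_one_iff_subsingleton _ (@Finite.of_subsingleton _ hs)).2 hs |>.trans
        (ellBound_pos hℓ.pos _ _)
    | n + 2 =>
      obtain ⟨hfin, hcard⟩ := ih (n + 1) (Nat.lt_succ_self _)
      let Q := EllQuotient ℓ L (n + 2)
      let p : Q →* EllQuotient ℓ L (n + 1) := ellProj ℓ L (Nat.le_succ (n + 1))
      -- A priori the generators generate only topologically. The abstract subgroup `D` is shown
      -- finite first; it is then closed, and hence everything.
      let D : Subgroup Q := Subgroup.closure (Set.range fun s => (QuotientGroup.mk (x s) : Q))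
      have hcomm : ∀ k ∈ p.ker, ∀ g : Q, k * g = g * k := by
        intro k hk g
        obtain ⟨k, rfl⟩ := QuotientGroup.mk_surjective k
        obtain ⟨g, rfl⟩ := QuotientGroup.mk_surjective g
        have hm := commutator_mem_ellCentral (mem_ellCentral_of_ellProj_eq_one _ hk) g
        have := (QuotientGroup.eq_one_iff (N := ellCentral ℓ L (n + 2)) _).2 hm
        exact commutatorElement_eq_one_iff_mul_comm.1 this
      have hexp : ∀ k ∈ p.ker, k ^ ℓ = 1 := by
        intro k hk
        obtain ⟨k, rfl⟩ := QuotientGroup.mk_surjective k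
        exact (QuotientGroup.eq_one_iff (N := ellCentral ℓ L (n + 2)) _).2
          (pow_mem_ellCentral (mem_ellCentral_of_ellProj_eq_one _ hk))
      have hgen : Subgroup.closure (Set.range fun s : Fin d =>
          (⟨QuotientGroup.mk (x s), Subgroup.subset_closure ⟨s, rfl⟩⟩ : D)) = ⊤ := by
        rw [eq_top_iff, ← Subgroup.closure_closure_coe_preimage]
        refine Subgroup.closure_mono ?_
        rintro ⟨_, _⟩ ⟨s, rfl⟩
        exact ⟨s, rfl⟩
      obtain ⟨hD, hDcard⟩ := finite_of_central_ker hℓ.pos (p.comp D.subtype)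
        (fun k hk g => Subtype.ext (hcomm k hk g)) (fun k hk => Subtype.ext (hexp k hk)) _ hgen
      have : IsClosed ((ellCentral ℓ L (n + 2) : Subgroup L) : Set L) := ellCentral_isClosed ℓ L _
      have hDtop : D = ⊤ := by
        have hc : IsClosed (D.comap (QuotientGroup.mk' (ellCentral ℓ L (n + 2))) : Set L) :=
          (Set.toFinite (D : Set Q)).isClosed.preimage QuotientGroup.continuous_mk
        have := hL.eq_top_of_isClosed hℓ _ hc fun s => Subgroup.subset_closure ⟨s, rfl⟩
        rw [eq_top_iff]
        intro y _
        obtain ⟨z, rfl⟩ := QuotientGroup.mk_surjective y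
        exact (Subgroup.ext_iff.1 this z).2 (Subgroup.mem_top z)
      rw [hDtop] at hD hDcard
      rw [Subgroup.card_top] at hDcard
      refine ⟨Finite.of_equiv _ Subgroup.topEquiv.toEquiv, hDcard.trans ?_⟩
      exact Nat.mul_le_mul hcard (Nat.pow_le_pow_right hℓ.pos (Nat.mul_le_mul_left _ hcard))

theorem IsFreeProEll.ellCentral_isOpen (hL : IsFreeProEll ℓ L x) (hℓ : ℓ.Prime) (n : ℕ) :
    IsOpen (ellCentral ℓ L n : Set L) := by
  have := (hL.ellQuotient_finite hℓ n).1
  have : (ellCentral ℓ L n).FiniteIndex := Subgroup.finiteIndex_of_finite_quotient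
  exact (ellCentral ℓ L n).isOpen_of_isClosed_of_finiteIndex (ellCentral_isClosed ℓ L n)

/-- A homomorphism to a group of order `ℓ ^ a` with open kernel is trivial on `L^[a + 1]`. -/
theorem ellCentral_le_ker (hℓ : ℓ.Prime) (a : ℕ) {F : Type u} [Group F]
    (hF : Nat.card F = ℓ ^ a) (f : L →* F) (hf : IsOpen (f.ker : Set L)) :
    ellCentral ℓ L (a + 1) ≤ f.ker := by
  have : Fact ℓ.Prime := ⟨hℓ⟩
  induction a generalizing F with
  | zero =>
    have : Finite F := Nat.finite_of_card_ne_zero (by simp [hF])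
    have : Subsingleton F := Finite.card_le_one_iff_subsingleton.1 (by simp [hF])
    exact fun y _ => Subsingleton.elim _ _
  | succ a ih =>
    have : Finite F := Nat.finite_of_card_ne_zero (by rw [hF]; exact pow_ne_zero _ hℓ.ne_zero)
    have hP : IsPGroup ℓ F := IsPGroup.of_card hF
    have : Nontrivial F := Finite.one_lt_card_iff_nontrivial.1
      (by rw [hF]; exact Nat.one_lt_pow (Nat.succ_ne_zero a) hℓ.one_lt)
    have := hP.center_nontrivial
    have hdvd : ℓ ∣ Nat.card (Subgroup.center F) := by
      obtain ⟨b, hb⟩ := (IsPGroup.iff_card.1 (hP.to_subgroup (Subgroup.center F)))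
      rw [hb]
      refine dvd_pow_self ℓ fun h0 => ?_
      have := Finite.one_lt_card (α := Subgroup.center F)
      rw [hb, h0] at this
      simp at this
    obtain ⟨z, hz⟩ := exists_prime_orderOf_dvd_card' ℓ hdvd
    let Z : Subgroup F := Subgroup.zpowers (z : F)
    have hZc : Z ≤ Subgroup.center F := Subgroup.zpowers_le.2 z.2
    have : Z.Normal := ⟨fun y hy g => by
      rwa [Subgroup.mem_center_iff.1 (hZc hy) g, mul_inv_cancel_right]⟩
    have hZcard : Nat.card Z = ℓ := by rw [Nat.card_zpowers, Subgroup.orderOf_coe, hz]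
    have hcard : Nat.card (F ⧸ Z) = ℓ ^ a := by
      have h := Z.card_eq_card_quotient_mul_card_subgroup
      rw [hF, hZcard, pow_succ] at h
      exact (Nat.eq_of_mul_eq_mul_right hℓ.pos h).symm
    -- Induction modulo a central subgroup `Z` of order `ℓ`: `f` maps `L^[a+1]` into `Z`, so the
    -- next step of the series, made of `ℓ`-th powers and commutators, goes to 1.
    have hle := ih hcard ((QuotientGroup.mk' Z).comp f) (Subgroup.isOpen_mono
      (fun y hy => by simp [MonoidHom.mem_ker, MonoidHom.mem_ker.1 hy]) hf)
    have hmem : ∀ y ∈ ellCentral ℓ L (a + 1), f y ∈ Z := fun y hy =>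
      (QuotientGroup.eq_one_iff (N := Z) (f y)).1 (hle hy)
    refine Subgroup.topologicalClosure_minimal _ (sup_le ?_ ?_) (Subgroup.isClosed_of_isOpen _ hf)
    · rw [Subgroup.closure_le]
      rintro _ ⟨h, hh, rfl⟩
      have := pow_card_eq_one' (x := (⟨f h, hmem h hh⟩ : Z))
      rw [hZcard] at this
      simpa [MonoidHom.mem_ker] using congrArg Subtype.val this
    · rw [Subgroup.commutator_le]
      intro h hh g _
      rw [MonoidHom.mem_ker, map_commutatorElement, commutatorElement_eq_one_iff_mul_comm]
      exact (Subgroup.mem_center_iff.1 (hZc (hmem h hh)) (f g)).symm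

end Quotients

/-! ### Cocycles with given values on the generators -/

section Cocycles

/-- The action on `Multiplicative M` by group automorphisms deduced from a representation. -/
def Representation.toMulAut {R G M : Type*} [CommRing R] [Group G] [AddCommGroup M] [Module R M]
    (ρ : Representation R G M) : G →* MulAut (Multiplicative M) where
  toFun g :=
    { toFun := fun v => Multiplicative.ofAdd (ρ g v.toAdd)
      invFun := fun v => Multiplicative.ofAdd (ρ g⁻¹ v.toAdd)
      left_inv := fun v => by simp
      right_inv := fun v => by simp
      map_mul' := fun v w => by simp }
  map_one' := by ext; simp
  map_mul' g h := by ext; simp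

theorem Representation.toMulAut_apply {R G M : Type*} [CommRing R] [Group G] [AddCommGroup M]
    [Module R M] (ρ : Representation R G M) (g : G) (v : Multiplicative M) :
    (ρ.toMulAut g v).toAdd = ρ g v.toAdd := rfl

variable {ℓ d : ℕ} {L : Type u} [Group L] [TopologicalSpace L] [IsTopologicalGroup L]
  {x : Fin d → L} {R : Type u} [CommRing R] {M : Type u} [AddCommGroup M] [Module R M]

theorem IsFreeProEll.closure_ellQuotient_eq_top (hL : IsFreeProEll ℓ L x) (hℓ : ℓ.Prime) (n : ℕ)
    (P : Subgroup (EllQuotient ℓ L n)) (hP : ∀ s, QuotientGroup.mk (x s) ∈ P) : P = ⊤ :=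
  hL.closure_eq_top_of_isOpen hℓ _ (hL.ellCentral_isOpen hℓ n) P hP

/-- Over a sufficiently deep quotient of `L`, there is a `1`-cocycle with arbitrarily given values
on the generators. -/
theorem IsFreeProEll.exists_cocycle (hL : IsFreeProEll ℓ L x) (hℓ : ℓ.Prime) {j k : ℕ}
    (hjk : j ≤ k) (ρ : Representation R (EllQuotient ℓ L j) M) {a : ℕ}
    (hM : Nat.card M = ℓ ^ a) (hk : Nat.card M * Nat.card (EllQuotient ℓ L j) ≤ k)
    (m : Fin d → M) :
    ∃ h : EllQuotient ℓ L k → M, (∀ y z, h (y * z) = ρ (ellProj ℓ L hjk y) (h z) + h y) ∧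
      ∀ s, h (QuotientGroup.mk (x s)) = m s := by
  have hopen := hL.ellCentral_isOpen hℓ j
  obtain ⟨b, hb⟩ := hL.isProEll.card_quotient (ellCentral ℓ L j) hopen
  -- The left component of a homomorphism to `E` lying over the projection to `L^(j)` is a
  -- 1-cocycle.
  let E := Multiplicative M ⋊[ρ.toMulAut] EllQuotient ℓ L j
  have hE : Nat.card E = ℓ ^ (a + b) := by
    rw [SemidirectProduct.card, Nat.card_congr Multiplicative.toAdd, hM, hb, pow_add]
  obtain ⟨f, hfo, hf⟩ := hL.exists_hom hℓ hE fun s =>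
    ⟨Multiplicative.ofAdd (m s), QuotientGroup.mk (x s)⟩
  have hright : SemidirectProduct.rightHom.comp f = QuotientGroup.mk' (ellCentral ℓ L j) := by
    refine hL.hom_ext hℓ hb (Subgroup.isOpen_mono (fun y hy => ?_) hfo)
      (QuotientGroup.isOpen_ker_mk' _ hopen) fun s => ?_
    · simp [MonoidHom.mem_ker, MonoidHom.mem_ker.1 hy]
    · simp [hf]
  -- `E` has order `ℓ ^ (a + b)`, so `L^[a+b+1]` dies in it; and `a + b < ℓ ^ (a + b) = |M|·|L^(j)|
  -- ≤ k`.
  have hle : a + b + 1 ≤ k := by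
    refine (Nat.succ_le_of_lt (Nat.lt_pow_self hℓ.one_lt)).trans ?_
    rwa [pow_add, ← hM, ← hb]
  have hker : ellCentral ℓ L k ≤ f.ker :=
    (ellCentral_antitone ℓ L hle).trans (ellCentral_le_ker hℓ _ hE f hfo)
  let F : EllQuotient ℓ L k →* E := QuotientGroup.lift _ f hker
  have hF : ∀ y, (F y).right = ellProj ℓ L hjk y := by
    intro y
    obtain ⟨y, rfl⟩ := QuotientGroup.mk_surjective y
    exact DFunLike.congr_fun hright y
  refine ⟨fun y => (F y).left.toAdd, fun y z => ?_, fun s => ?_⟩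
  · beta_reduce
    rw [map_mul, SemidirectProduct.mul_left, hF, toAdd_mul, Representation.toMulAut_apply, add_comm]
  · change (f (x s)).left.toAdd = m s
    rw [hf]
    rfl

/-- Two `1`-cocycles that agree on the generators are equal. -/
theorem IsFreeProEll.cocycle_ext (hL : IsFreeProEll ℓ L x) (hℓ : ℓ.Prime) {k : ℕ}
    (ρ : Representation R (EllQuotient ℓ L k) M) {h h' : EllQuotient ℓ L k → M}
    (hh : ∀ y z, h (y * z) = ρ y (h z) + h y) (hh' : ∀ y z, h' (y * z) = ρ y (h' z) + h' y)
    (heq : ∀ s, h (QuotientGroup.mk (x s)) = h' (QuotientGroup.mk (x s))) : h = h' := by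
  have h1 : h 1 = h' 1 := by
    have e := hh 1 1
    have e' := hh' 1 1
    simp only [mul_one, map_one, Module.End.one_apply, left_eq_add] at e e'
    rw [e, e']
  let P : Subgroup (EllQuotient ℓ L k) :=
    { carrier := {y | h y = h' y}
      one_mem' := h1
      mul_mem' := fun {y z} hy hz => by
        simp only [Set.mem_ofPred_eq] at hy hz ⊢
        rw [hh, hh', hy, hz]
      inv_mem' := fun {y} hy => by
        simp only [Set.mem_ofPred_eq] at hy ⊢
        have e := hh y⁻¹ y
        have e' := hh' y⁻¹ y
        rw [inv_mul_cancel] at e e'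
        rw [h1, hy, e'] at e
        exact (add_left_cancel e).symm }
  have hP := hL.closure_ellQuotient_eq_top hℓ k P heq
  funext y
  exact (Subgroup.ext_iff.1 hP y).2 (Subgroup.mem_top y)

end Cocycles

/-! ### Inhomogeneous cochains -/

section Cochains

variable {R G H : Type u} [CommRing R] [Group G] [Group H] {V W : Type u} [AddCommGroup V]
  [Module R V] [AddCommGroup W] [Module R W]

/-- The differential of the complex of inhomogeneous cochains of a representation. -/
noncomputable def coboundary (ρ : Representation R G V) (n : ℕ) :
    ((Fin n → G) → V) →ₗ[R] ((Fin (n + 1) → G) → V) :=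
  (inhomogeneousCochains.d (Rep.of ρ) n).hom

theorem coboundary_apply (ρ : Representation R G V) (n : ℕ) (f : (Fin n → G) → V)
    (g : Fin (n + 1) → G) :
    coboundary ρ n f g = ρ (g 0) (f fun i => g i.succ) + ∑ j : Fin (n + 1),
      (-1 : R) ^ ((j : ℕ) + 1) • f (Fin.contractNth j (· * ·) g) := rfl

theorem coboundary_coboundary (ρ : Representation R G V) (n : ℕ) (f : (Fin n → G) → V) :
    coboundary ρ (n + 1) (coboundary ρ n f) = 0 := by
  have h := groupCohomology.inhomogeneousCochains.d_comp_d (A := Rep.of ρ) (n := n)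
  exact congrArg (fun φ => φ.hom f) h

/-- Used with `φ` the identity for inflation, and with `p` the identity for change of coefficients.
-/
theorem coboundary_comp (ρ : Representation R G V) (σ : Representation R H W) (p : H →* G)
    (φ : V →ₗ[R] W) (hφ : ∀ h v, φ (ρ (p h) v) = σ h (φ v)) (n : ℕ) (f : (Fin n → G) → V) :
    coboundary σ n (fun y => φ (f (p ∘ y))) = fun y => φ (coboundary ρ n f (p ∘ y)) := by
  funext y
  simp only [coboundary_apply, map_add, map_sum, map_smul, Function.comp_apply, hφ]
  congr 1
  refine Finset.sum_congr rfl fun j _ => ?_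
  congr 3
  exact Fin.comp_contractNth _ _ (fun a b => map_mul p a b) _ _

theorem coboundary_one_eq_zero_iff (ρ : Representation R G V) (f : (Fin 1 → G) → V) :
    coboundary ρ 1 f = 0 ↔
      ∀ a b, f (fun _ => a * b) = ρ a (f fun _ => b) + f fun _ => a := by
  have key : ∀ g : Fin 2 → G, coboundary ρ 1 f g =
      ρ (g 0) (f fun _ => g 1) + (-f (fun _ => g 0 * g 1) + f fun _ => g 0) := by
    intro g
    rw [coboundary_apply, Fin.sum_univ_two]
    have h0 : Fin.contractNth (0 : Fin 2) (· * ·) g = fun _ => g 0 * g 1 := by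
      funext i; fin_cases i; rfl
    have h1 : Fin.contractNth (1 : Fin 2) (· * ·) g = fun _ => g 0 := by
      funext i; fin_cases i; rfl
    have h2 : (fun i : Fin 1 => g i.succ) = fun _ => g 1 := by
      funext i; fin_cases i; rfl
    rw [h0, h1, h2]
    simp
  constructor
  · intro h a b
    have := congrFun h ![a, b]
    rw [key] at this
    simp only [Matrix.cons_val_zero, Matrix.cons_val_one, Pi.zero_apply] at this
    rw [← sub_eq_zero, ← neg_eq_zero, ← this]
    abel
  · intro h
    funext g
    rw [key, h]
    simp

/-- Functions on the group, with the action by right translations. -/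
def translationRep (R G V : Type u) [CommRing R] [Group G] [AddCommGroup V] [Module R V] :
    Representation R G (G → V) where
  toFun g := LinearMap.funLeft R V fun y => y * g
  map_one' := by ext; simp [LinearMap.funLeft]
  map_mul' g h := by ext; simp [LinearMap.funLeft, mul_assoc]

theorem translationRep_apply (g : G) (F : G → V) (y : G) :
    translationRep R G V g F y = F (y * g) := rfl

/-- The embedding of a representation in the functions on the group. -/
def orbitMap (ρ : Representation R G V) : V →ₗ[R] (G → V) :=
  LinearMap.pi fun y => ρ y

theorem orbitMap_apply (ρ : Representation R G V) (v : V) (y : G) : orbitMap ρ v y = ρ y v := rfl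

theorem orbitMap_injective (ρ : Representation R G V) : Function.Injective (orbitMap ρ) := by
  intro v w h
  simpa [orbitMap_apply] using congrFun h 1

theorem orbitMap_equivariant (ρ : Representation R G V) (g : G) (v : V) :
    orbitMap ρ (ρ g v) = translationRep R G V g (orbitMap ρ v) := by
  funext y
  simp [translationRep_apply, orbitMap_apply]

/-- The quotient of the functions on the group by the image of `orbitMap`. -/
def cokernelRep (ρ : Representation R G V) :
    Representation R G ((G → V) ⧸ LinearMap.range (orbitMap ρ)) :=
  (translationRep R G V).quotient _ fun g => by
    rintro _ ⟨v, rfl⟩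
    exact ⟨ρ g v, orbitMap_equivariant ρ g v⟩

theorem cokernelRep_mkQ (ρ : Representation R G V) (g : G) (F : G → V) :
    (LinearMap.range (orbitMap ρ)).mkQ (translationRep R G V g F) =
      cokernelRep ρ g ((LinearMap.range (orbitMap ρ)).mkQ F) := rfl

/-- A cocycle of positive degree becomes a coboundary in the functions on the group. -/
theorem exists_coboundary_eq_orbitMap (ρ : Representation R G V) {n : ℕ}
    (f : (Fin (n + 1) → G) → V) (hf : coboundary ρ (n + 1) f = 0) :
    ∃ g : (Fin n → G) → (G → V),
      coboundary (translationRep R G V) n g = fun y => orbitMap ρ (f y) := by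
  -- The contracting homotopy `g(y)(z) = f(z, y)`. In the cocycle identity for `f` at `(z, y)`, the
  -- leading term is `orbitMap ρ (f y) z`, the term multiplying `z` by `y 0` is the translation
  -- action on `g`, and the others complete `-dg`.
  refine ⟨fun y z => f (Fin.cons z y), ?_⟩
  funext y z
  have h := congrFun hf (Fin.cons z y)
  rw [coboundary_apply, Fin.sum_univ_succ] at h
  have h0 : Fin.contractNth (0 : Fin (n + 2)) (· * ·) (Fin.cons z y : Fin (n + 2) → G) =
      Fin.cons (z * y 0) fun i => y i.succ := by
    funext i
    refine Fin.cases ?_ (fun i => ?_) i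
    · simp [Fin.contractNth]
    · simp [Fin.contractNth]
  have hs : ∀ j : Fin (n + 1), Fin.contractNth j.succ (· * ·) (Fin.cons z y : Fin (n + 2) → G) =
      Fin.cons z (Fin.contractNth j (· * ·) y) := by
    intro j
    funext i
    refine Fin.cases ?_ (fun i => ?_) i
    · simp [Fin.contractNth]
    · simp [Fin.contractNth]
  simp only [h0, hs, Fin.cons_zero, Fin.cons_succ, Fin.val_zero, zero_add, pow_one, neg_smul,
    one_smul, Pi.zero_apply, Fin.val_succ, pow_succ (-1 : R) (_ + 1), mul_neg, mul_one,
    Finset.sum_neg_distrib] at h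
  rw [coboundary_apply, orbitMap_apply]
  simp only [Pi.add_apply, translationRep_apply, Finset.sum_apply, Pi.smul_apply]
  rw [← sub_eq_zero, ← neg_eq_zero, ← h]
  abel

/-- The restriction along `p` of a cocycle is a coboundary if, in the functions on the group, it
is the restriction of the coboundary of a cochain that lifts to a cocycle modulo `V`. -/
theorem exists_coboundary_eq_comp (ρ : Representation R G V) (p : H →* G) {n : ℕ}
    (f : (Fin (n + 1) → G) → V) (g : (Fin n → G) → (G → V))
    (hg : coboundary (translationRep R G V) n g = fun y => orbitMap ρ (f y))
    (h : (Fin n → H) → (G → V)) (hh : coboundary ((translationRep R G V).comp p) n h = 0)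
    (hgh : ∀ y, (LinearMap.range (orbitMap ρ)).mkQ (h y) =
      (LinearMap.range (orbitMap ρ)).mkQ (g (p ∘ y))) :
    ∃ u : (Fin n → H) → V, coboundary (ρ.comp p) n u = fun y => f (p ∘ y) := by
  -- The inflation of `g` minus `h` is `V`-valued; as `h` is a cocycle, its coboundary is the
  -- inflation of `f`.
  have hex : ∀ y, ∃ v, orbitMap ρ v = g (p ∘ y) - h y := by
    intro y
    have := (Submodule.Quotient.eq _).1 (hgh y).symm
    exact this
  choose u hu using hex
  refine ⟨u, ?_⟩
  funext y
  apply orbitMap_injective ρ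
  have e1 := congrFun (coboundary_comp (ρ.comp p) ((translationRep R G V).comp p)
    (MonoidHom.id H) (orbitMap ρ) (fun k v => orbitMap_equivariant ρ (p k) v) n u) y
  have e2 := congrFun (coboundary_comp (translationRep R G V) ((translationRep R G V).comp p)
    p LinearMap.id (fun k v => rfl) n g) y
  have e3 : (fun y : Fin n → H => orbitMap ρ (u (MonoidHom.id H ∘ y))) =
      (fun y => (LinearMap.id : (G → V) →ₗ[R] (G → V)) (g (p ∘ y))) - h := by
    funext y
    exact hu y
  rw [e3, map_sub, hh, sub_zero, e2, hg] at e1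
  exact e1.symm

end Cochains

/-! ### Cohomology classes of cochains -/

section Classes

open groupCohomology

variable {R G H : Type u} [CommRing R] [Group G] [Group H]

/-- Allows classes to be handled through explicit cochains. -/
theorem groupCohomology.exists_eq_π_cocyclesMk (A : Rep.{u} R G) {n : ℕ} (c : groupCohomology A n) :
    ∃ (f : (Fin n → G) → A) (hf : inhomogeneousCochains.d A n f = 0),
      c = π A n (cocyclesMk f hf) := by
  induction c using groupCohomology_induction_on with
  | h z =>
    have hz : inhomogeneousCochains.d A n (iCocycles A n z) = 0 := by
      have h := (inhomogeneousCochains A).iCycles_d n (n + 1)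
      rw [inhomogeneousCochains.d_def] at h
      exact congrArg (fun φ => φ.hom z) h
    refine ⟨iCocycles A n z, hz, ?_⟩
    congr 1
    apply (ModuleCat.mono_iff_injective (iCocycles A n)).1 inferInstance
    rw [iCocycles_mk]

theorem groupCohomology.d_comp_eq_zero {A : Rep.{u} R G} {B : Rep.{u} R H} (p : H →* G)
    (φ : Rep.res p A ⟶ B) {n : ℕ} {f : (Fin n → G) → A}
    (hf : inhomogeneousCochains.d A n f = 0) :
    inhomogeneousCochains.d B n (fun y => φ.hom (f (p ∘ y))) = 0 := by
  have h := (cochainsMap p φ).comm n (n + 1)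
  rw [inhomogeneousCochains.d_def, inhomogeneousCochains.d_def] at h
  have h' := congrArg (fun ψ => ψ.hom f) h
  have h'' : inhomogeneousCochains.d B n (fun y => φ.hom (f (p ∘ y))) =
    (cochainsMap p φ).f (n + 1) (inhomogeneousCochains.d A n f) := h'
  rw [h'', hf, map_zero]

theorem groupCohomology.map_π_cocyclesMk {A : Rep.{u} R G} {B : Rep.{u} R H} (p : H →* G)
    (φ : Rep.res p A ⟶ B) {n : ℕ} {f : (Fin n → G) → A}
    (hf : inhomogeneousCochains.d A n f = 0) :
    groupCohomology.map p φ n (π A n (cocyclesMk f hf)) =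
      π B n (cocyclesMk (fun y => φ.hom (f (p ∘ y))) (d_comp_eq_zero p φ hf)) := by
  rw [π_map_apply]
  congr 1
  apply (ModuleCat.mono_iff_injective (iCocycles B n)).1 inferInstance
  rw [iCocycles_mk]
  have h := HomologicalComplex.cyclesMap_i (cochainsMap p φ) n
  have h' := congrArg (fun ψ => ψ.hom (cocyclesMk f hf)) h
  have h'' : iCocycles B n (cocyclesMap p φ n (cocyclesMk f hf)) =
    (cochainsMap p φ).f n (iCocycles A n (cocyclesMk f hf)) := h'
  rw [h'', iCocycles_mk]
  rfl

theorem groupCohomology.π_eq_zero_iff (A : Rep.{u} R G) {n m : ℕ}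
    (hm : (ComplexShape.up ℕ).prev n = m) (z : cocycles A n) :
    π A n z = 0 ↔ ∃ u, toCocycles A m n u = z := by
  have hex := ShortComplex.exact_of_g_is_cokernel
    (ShortComplex.mk _ _ ((inhomogeneousCochains A).toCycles_comp_homologyπ m n))
    ((inhomogeneousCochains A).homologyIsCokernel m n hm)
  constructor
  · exact fun h => (ShortComplex.moduleCat_exact_iff _).1 hex z h
  · rintro ⟨u, rfl⟩
    exact congrArg (fun ψ => ψ.hom u) ((inhomogeneousCochains A).toCycles_comp_homologyπ m n)

theorem groupCohomology.π_cocyclesMk_succ_eq_zero_iff {A : Rep.{u} R G} {n : ℕ}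
    {f : (Fin (n + 1) → G) → A} (hf : inhomogeneousCochains.d A (n + 1) f = 0) :
    π A (n + 1) (cocyclesMk f hf) = 0 ↔ ∃ u, inhomogeneousCochains.d A n u = f := by
  rw [groupCohomology.π_eq_zero_iff A (CochainComplex.prev_nat_succ n)]
  refine exists_congr fun u => ?_
  have h : iCocycles A (n + 1) (toCocycles A n (n + 1) u) = inhomogeneousCochains.d A n u := by
    rw [← inhomogeneousCochains.d_def]
    exact congrArg (fun ψ => ψ.hom u) ((inhomogeneousCochains A).toCycles_i n (n + 1))
  rw [← h]
  constructor
  · intro e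
    rw [e, iCocycles_mk]
  · intro e
    apply (ModuleCat.mono_iff_injective (iCocycles A (n + 1))).1 inferInstance
    rw [e, iCocycles_mk]

theorem groupCohomology.eq_zero_of_π_cocyclesMk_zero_eq_zero {A : Rep.{u} R G}
    {f : (Fin 0 → G) → A} (hf : inhomogeneousCochains.d A 0 f = 0)
    (h : π A 0 (cocyclesMk f hf) = 0) : f = 0 := by
  obtain ⟨u, hu⟩ := (groupCohomology.π_eq_zero_iff A CochainComplex.prev_nat_zero _).1 h
  have h1 : iCocycles A 0 (toCocycles A 0 0 u) = (inhomogeneousCochains A).d 0 0 u :=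
    congrArg (fun ψ => ψ.hom u) ((inhomogeneousCochains A).toCycles_i 0 0)
  -- The predecessor of degree 0 is by convention 0 itself, and the differential from degree 0 to
  -- degree 0 is zero.
  rw [(inhomogeneousCochains A).shape 0 0 (by simp), hu, iCocycles_mk] at h1
  exact h1

end Classes

/-! ### Vanishing of inflation in degrees at least two -/

section Vanishing

variable {ℓ d : ℕ} {L : Type u} [Group L] [TopologicalSpace L] [IsTopologicalGroup L]
  {x : Fin d → L} {R : Type u} [CommRing R]

/-- Cocycles of degree at least two become coboundaries over a sufficiently deep quotient. -/
theorem IsFreeProEll.exists_coboundary_eq (hL : IsFreeProEll ℓ L x) (hℓ : ℓ.Prime) {j k : ℕ}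
    (hjk : j ≤ k) (i : ℕ) {V : Type u} [AddCommGroup V] [Module R V]
    (ρ : Representation R (EllQuotient ℓ L j) V) {a : ℕ} (hV : Nat.card V = ℓ ^ a)
    (hk : Nat.card V ^ Nat.card (EllQuotient ℓ L j) ^ (i + 1) * Nat.card (EllQuotient ℓ L j) ≤ k)
    (f : (Fin (i + 2) → EllQuotient ℓ L j) → V) (hf : coboundary ρ (i + 2) f = 0) :
    ∃ u : (Fin (i + 1) → EllQuotient ℓ L k) → V,
      coboundary (ρ.comp (ellProj ℓ L hjk)) (i + 1) u = fun y => f (ellProj ℓ L hjk ∘ y) := by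
  have hfin := (hL.ellQuotient_finite hℓ j).1
  induction i generalizing V a with
  | zero =>
    obtain ⟨g, hg⟩ := exists_coboundary_eq_orbitMap ρ f hf
    have hM : Nat.card (EllQuotient ℓ L j → V) = ℓ ^ (a * Nat.card (EllQuotient ℓ L j)) := by
      rw [Nat.card_fun, hV, pow_mul]
    -- The prescribed values are those of `g`. Modulo `V` both `h` and the inflation of `g` are
    -- 1-cocycles, so agreement on the generators forces agreement everywhere.
    obtain ⟨h, hh, hhx⟩ := hL.exists_cocycle hℓ hjk (translationRep R (EllQuotient ℓ L j) V) hM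
      (by rw [Nat.card_fun]; simpa using hk) fun s => g fun _ => QuotientGroup.mk (x s)
    have hz : coboundary (cokernelRep ρ) 1
        (fun y => (LinearMap.range (orbitMap ρ)).mkQ (g y)) = 0 := by
      have e := coboundary_comp (translationRep R _ V) (cokernelRep ρ) (MonoidHom.id _)
        (LinearMap.range (orbitMap ρ)).mkQ (fun k v => cokernelRep_mkQ ρ k v) 1 g
      refine e.trans ?_
      funext y
      rw [hg]
      exact (Submodule.Quotient.mk_eq_zero _).2 ⟨_, rfl⟩
    rw [coboundary_one_eq_zero_iff] at hz
    have heq := hL.cocycle_ext hℓ ((cokernelRep ρ).comp (ellProj ℓ L hjk))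
      (h := fun y => (LinearMap.range (orbitMap ρ)).mkQ (h y))
      (h' := fun y => (LinearMap.range (orbitMap ρ)).mkQ (g fun _ => ellProj ℓ L hjk y))
      (fun y z => by rw [hh, map_add, cokernelRep_mkQ]; rfl)
      (fun y z => by rw [map_mul]; exact hz _ _)
      (fun s => by rw [hhx]; rfl)
    refine exists_coboundary_eq_comp ρ _ f g hg (fun y => h (y 0)) ?_ fun y => ?_
    · rw [coboundary_one_eq_zero_iff]
      exact fun y z => hh y z
    · refine (congrFun heq (y 0)).trans ?_
      congr 2
      funext i
      rw [Subsingleton.elim i 0]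
      rfl
  | succ i ih =>
    obtain ⟨g, hg⟩ := exists_coboundary_eq_orbitMap ρ f hf
    have hM : Nat.card (EllQuotient ℓ L j → V) = ℓ ^ (a * Nat.card (EllQuotient ℓ L j)) := by
      rw [Nat.card_fun, hV, pow_mul]
    let N := LinearMap.range (orbitMap ρ)
    have hdvd : Nat.card ((EllQuotient ℓ L j → V) ⧸ N) ∣ Nat.card (EllQuotient ℓ L j → V) :=
      ⟨Nat.card N, by rw [Nat.mul_comm]; exact N.card_eq_card_quotient_mul_card⟩
    have hle : Nat.card ((EllQuotient ℓ L j → V) ⧸ N) ≤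
        Nat.card V ^ Nat.card (EllQuotient ℓ L j) := by
      rw [← Nat.card_fun]
      exact Nat.le_of_dvd (by rw [hM]; exact Nat.pow_pos hℓ.pos) hdvd
    obtain ⟨b, -, hb⟩ := (Nat.dvd_prime_pow hℓ).1 (hM ▸ hdvd)
    have hz : coboundary (cokernelRep ρ) (i + 2) (fun y => N.mkQ (g y)) = 0 := by
      have e := coboundary_comp (translationRep R _ V) (cokernelRep ρ) (MonoidHom.id _)
        N.mkQ (fun k v => cokernelRep_mkQ ρ k v) (i + 2) g
      refine e.trans ?_
      funext y
      rw [hg]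
      exact (Submodule.Quotient.mk_eq_zero _).2 ⟨_, rfl⟩
    -- The quotient has order at most `|V| ^ |G|`, with `G = L^(j)`, which raises the exponent `|G|
    -- ^ (i + 1)` to `|G| ^ (i + 2)`. The group `G` and the level `k` stay fixed throughout the
    -- induction.
    obtain ⟨w, hw⟩ := ih (cokernelRep ρ) hb (le_trans (Nat.mul_le_mul_right _
      ((Nat.pow_le_pow_left hle _).trans_eq (by rw [← pow_mul, ← pow_succ']))) hk) _ hz
    -- A merely set-theoretic lift suffices: its coboundary is automatically a cocycle, and it lifts
    -- the coboundary of `w`.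
    choose w' hw' using fun y => N.mkQ_surjective (w y)
    refine exists_coboundary_eq_comp ρ _ f g hg
      (coboundary ((translationRep R _ V).comp (ellProj ℓ L hjk)) (i + 1) w')
      (coboundary_coboundary _ _ _) fun y => ?_
    have e := congrFun (coboundary_comp ((translationRep R _ V).comp (ellProj ℓ L hjk))
      ((cokernelRep ρ).comp (ellProj ℓ L hjk)) (MonoidHom.id _) N.mkQ
      (fun k v => cokernelRep_mkQ ρ (ellProj ℓ L hjk k) v) (i + 1) w') y
    refine e.symm.trans ?_
    rw [← congrFun hw y]
    exact congrArg (fun v => coboundary ((cokernelRep ρ).comp (ellProj ℓ L hjk)) (i + 1) v y)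
      (funext hw')

end Vanishing

/-! ### Criteria for essential constancy -/

section Criteria

variable {R : Type u} [Ring R] {i₀ : ℕ} (A : Set.Ici i₀ ⥤ ModuleCat.{u} R)

theorem transition_comp {j k l : ℕ} (hj : i₀ ≤ j) (hjk : j ≤ k) (hkl : k ≤ l) :
    transition A hj (hjk.trans hkl) =
      (transition A (hj.trans hjk) hkl).comp (transition A hj hjk) := by
  have h := A.map_comp
    (homOfLE (show (⟨j, hj⟩ : Set.Ici i₀) ≤ ⟨k, hj.trans hjk⟩ from hjk))
    (homOfLE (show (⟨k, hj.trans hjk⟩ : Set.Ici i₀) ≤ ⟨l, (hj.trans hjk).trans hkl⟩ from hkl))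
  exact congrArg ModuleCat.Hom.hom h

/-- All kernels vanish, and `A_N → A_φ(j)` factors through the surjection `A_N → A_j`, so the images
agree. -/
theorem IsEssentiallyConstant.of_bijective {N : ℕ} {φ : ℕ → ℕ} (hN : i₀ ≤ N) (hφ : ∀ j, j ≤ φ j)
    (hinj : ∀ j k (hj : i₀ ≤ j) (hjk : j ≤ k), LinearMap.ker (transition A hj hjk) = ⊥)
    (hsurj : ∀ j (hj : N ≤ j), LinearMap.range (transition A hN hj) = ⊤) :
    IsEssentiallyConstant A N φ where
  le_N := hN
  le_phi j _ := hφ j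
  ker_eq j k hj hk := by rw [hinj, hinj]
  range_eq j hj := by
    rw [transition_comp A hN hj (hφ j), LinearMap.range_comp, hsurj j hj, Submodule.map_top]

/-- What is zero at `φ j` stays zero beyond it, so both kernels are all of `A_j` and both images are
zero. -/
theorem IsEssentiallyConstant.of_eq_zero {N : ℕ} {φ : ℕ → ℕ} (hN : i₀ ≤ N) (hφ : ∀ j, j ≤ φ j)
    (h : ∀ j (hj : i₀ ≤ j), transition A hj (hφ j) = 0) :
    IsEssentiallyConstant A N φ where
  le_N := hN
  le_phi j _ := hφ j
  ker_eq j k hj hk := by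
    rw [transition_comp A hj (hφ j) hk, h j hj, LinearMap.comp_zero]
    simp
  range_eq j hj := by
    rw [transition_comp A hN hj (hφ j), h j (hN.trans hj), LinearMap.zero_comp]
    simp

end Criteria

/-! ### The inductive system of cohomology groups -/

section System

open groupCohomology

variable {ℓ d : ℕ} {L : Type u} [Group L] [TopologicalSpace L] [IsTopologicalGroup L]
  {x : Fin d → L} {Λ : Type u} [CommRing Λ] {V : Type u} [AddCommGroup V] [Module Λ V]
  {n₀ : ℕ} (ρ : Representation Λ (EllQuotient ℓ L n₀) V)

/-- The action of `L^(n)` on `V`, as a representation. -/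
abbrev inflatedRep {n : ℕ} (hn : n₀ ≤ n) : Representation Λ (EllQuotient ℓ L n) V :=
  ρ.comp (ellProj ℓ L hn)

theorem inflatedRep_comp {j k : ℕ} (hj : n₀ ≤ j) (hjk : j ≤ k) :
    (inflatedRep ρ hj).comp (ellProj ℓ L hjk) = inflatedRep ρ (hj.trans hjk) := by
  rw [MonoidHom.comp_assoc, ellProj_comp]

theorem coboundary_inflate {j k : ℕ} (hj : n₀ ≤ j) (hjk : j ≤ k) (i : ℕ)
    (f : (Fin i → EllQuotient ℓ L j) → V) :
    coboundary (inflatedRep ρ (hj.trans hjk)) i (fun y => f (ellProj ℓ L hjk ∘ y)) =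
      fun y => coboundary (inflatedRep ρ hj) i f (ellProj ℓ L hjk ∘ y) :=
  coboundary_comp (inflatedRep ρ hj) (inflatedRep ρ (hj.trans hjk)) (ellProj ℓ L hjk)
    (LinearMap.id : V →ₗ[Λ] V)
    (fun g v => congrArg (fun σ => σ g v) (inflatedRep_comp ρ hj hjk)) i f

/-- The class of a cocycle in the inductive system. -/
noncomputable def cocycleClass {j : ℕ} (hj : n₀ ≤ j) {i : ℕ} {f : (Fin i → EllQuotient ℓ L j) → V}
    (hf : coboundary (inflatedRep ρ hj) i f = 0) : (cohomologySystem ρ i).obj ⟨j, hj⟩ :=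
  π (inflated ρ ⟨j, hj⟩) i (cocyclesMk (A := inflated ρ ⟨j, hj⟩) f hf)

theorem exists_eq_cocycleClass {j : ℕ} (hj : n₀ ≤ j) {i : ℕ}
    (c : (cohomologySystem ρ i).obj ⟨j, hj⟩) :
    ∃ (f : (Fin i → EllQuotient ℓ L j) → V) (hf : coboundary (inflatedRep ρ hj) i f = 0),
      c = cocycleClass ρ hj hf :=
  groupCohomology.exists_eq_π_cocyclesMk (inflated ρ ⟨j, hj⟩) c

theorem coboundary_inflate_eq_zero {j k : ℕ} (hj : n₀ ≤ j) (hjk : j ≤ k) {i : ℕ}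
    {f : (Fin i → EllQuotient ℓ L j) → V} (hf : coboundary (inflatedRep ρ hj) i f = 0) :
    coboundary (inflatedRep ρ (hj.trans hjk)) i (fun y => f (ellProj ℓ L hjk ∘ y)) = 0 := by
  rw [coboundary_inflate ρ hj hjk, hf]
  rfl

theorem transition_cocycleClass {j k : ℕ} (hj : n₀ ≤ j) (hjk : j ≤ k) {i : ℕ}
    {f : (Fin i → EllQuotient ℓ L j) → V} (hf : coboundary (inflatedRep ρ hj) i f = 0) :
    transition (cohomologySystem ρ i) hj hjk (cocycleClass ρ hj hf) =
      cocycleClass ρ (hj.trans hjk) (coboundary_inflate_eq_zero ρ hj hjk hf) :=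
  groupCohomology.map_π_cocyclesMk (A := inflated ρ ⟨j, hj⟩)
    (B := inflated ρ ⟨k, hj.trans hjk⟩) (ellProj ℓ L hjk)
    (inflatedId ρ (n := ⟨j, hj⟩) (m := ⟨k, hj.trans hjk⟩) hjk) hf

theorem cocycleClass_succ_eq_zero_iff {j : ℕ} (hj : n₀ ≤ j) {i : ℕ}
    {f : (Fin (i + 1) → EllQuotient ℓ L j) → V}
    (hf : coboundary (inflatedRep ρ hj) (i + 1) f = 0) :
    cocycleClass ρ hj hf = 0 ↔ ∃ u, coboundary (inflatedRep ρ hj) i u = f :=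
  groupCohomology.π_cocyclesMk_succ_eq_zero_iff (A := inflated ρ ⟨j, hj⟩) hf

theorem eq_zero_of_cocycleClass_zero_eq_zero {j : ℕ} (hj : n₀ ≤ j)
    {f : (Fin 0 → EllQuotient ℓ L j) → V} (hf : coboundary (inflatedRep ρ hj) 0 f = 0)
    (h : cocycleClass ρ hj hf = 0) : f = 0 :=
  groupCohomology.eq_zero_of_π_cocyclesMk_zero_eq_zero (A := inflated ρ ⟨j, hj⟩) hf h

theorem comp_ellProj_injective {j k : ℕ} (hjk : j ≤ k) {i : ℕ} {W : Type*}
    {f f' : (Fin i → EllQuotient ℓ L j) → W}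
    (h : ∀ y, f (ellProj ℓ L hjk ∘ y) = f' (ellProj ℓ L hjk ∘ y)) : f = f' := by
  funext y
  obtain ⟨z, rfl⟩ := (ellProj_surjective hjk).comp_left y
  exact h z

/-- Inflation is injective in degrees `0` and `1`. -/
theorem ker_transition_eq_bot {i : ℕ} (hi : i ≤ 1) {j k : ℕ} (hj : n₀ ≤ j) (hjk : j ≤ k) :
    LinearMap.ker (transition (cohomologySystem ρ i) hj hjk) = ⊥ := by
  rw [LinearMap.ker_eq_bot']
  intro c hc
  obtain ⟨f, hf, rfl⟩ := exists_eq_cocycleClass ρ hj c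
  rw [transition_cocycleClass] at hc
  match i, hi with
  | 0, _ =>
    have h0 := eq_zero_of_cocycleClass_zero_eq_zero ρ _ _ hc
    have : f = 0 := comp_ellProj_injective hjk (congrFun h0)
    subst this
    have hz : cocyclesMk (A := inflated ρ ⟨j, hj⟩) 0 hf = 0 := by
      apply (ModuleCat.mono_iff_injective (iCocycles (inflated ρ ⟨j, hj⟩) 0)).1 inferInstance
      exact (iCocycles_mk (A := inflated ρ ⟨j, hj⟩) 0 hf).trans (map_zero _).symm
    exact (congrArg (π (inflated ρ ⟨j, hj⟩) 0) hz).trans (map_zero _)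
  | 1, _ =>
    rw [cocycleClass_succ_eq_zero_iff] at hc ⊢
    obtain ⟨u, hu⟩ := hc
    -- A 0-cochain is an element of `V`, so it already lives at level `j`.
    refine ⟨fun _ => u Fin.elim0, comp_ellProj_injective hjk fun y => ?_⟩
    rw [← congrFun (coboundary_inflate ρ hj hjk 0 fun _ => u Fin.elim0) y, ← congrFun hu y]
    refine congrArg (fun v => coboundary (inflatedRep ρ (hj.trans hjk)) 0 v y) (funext fun z => ?_)
    rw [Subsingleton.elim z Fin.elim0]

/-- Inflation is surjective in degrees `0` and `1` from a sufficiently deep level on. -/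
theorem IsFreeProEll.range_transition_eq_top (hL : IsFreeProEll ℓ L x) (hℓ : ℓ.Prime) {a : ℕ}
    (hV : Nat.card V = ℓ ^ a) {i : ℕ} (hi : i ≤ 1) {N j : ℕ} (hN : n₀ ≤ N) (hNj : N ≤ j)
    (hle : Nat.card V * Nat.card (EllQuotient ℓ L n₀) ≤ N) :
    LinearMap.range (transition (cohomologySystem ρ i) hN hNj) = ⊤ := by
  rw [LinearMap.range_eq_top]
  intro c
  obtain ⟨f, hf, rfl⟩ := exists_eq_cocycleClass ρ (hN.trans hNj) c
  suffices h : ∃ f' : (Fin i → EllQuotient ℓ L N) → V,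
      (fun y => f' (ellProj ℓ L hNj ∘ y)) = f by
    obtain ⟨f', rfl⟩ := h
    have hf' : coboundary (inflatedRep ρ hN) i f' = 0 := comp_ellProj_injective hNj fun y => by
      rw [← congrFun (coboundary_inflate ρ hN hNj i f') y, hf]
      rfl
    exact ⟨cocycleClass ρ hN hf', transition_cocycleClass ρ hN hNj hf'⟩
  match i, hi with
  | 0, _ => exact ⟨fun _ => f Fin.elim0, funext fun y => by rw [Subsingleton.elim y Fin.elim0]⟩
  | 1, _ =>
    -- The passage is from `n₀` to `N`, through which the action factors, so the required `N` does
    -- not depend on `j`. Inflated to level `j`, `h` agrees with `f` on the generators.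
    obtain ⟨h, hh, hhx⟩ := hL.exists_cocycle hℓ hN ρ hV hle
      fun s => f fun _ => QuotientGroup.mk (x s)
    rw [coboundary_one_eq_zero_iff] at hf
    have heq := hL.cocycle_ext hℓ (inflatedRep ρ (hN.trans hNj))
      (h := fun y => h (ellProj ℓ L hNj y)) (h' := fun y => f fun _ => y)
      (fun y z => by
        rw [map_mul, hh]
        exact congrArg (fun σ => σ y (h (ellProj ℓ L hNj z)) + h (ellProj ℓ L hNj y))
          (inflatedRep_comp ρ hN hNj))
      hf hhx
    refine ⟨fun y => h (y 0), funext fun y => (congrFun heq (y 0)).trans ?_⟩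
    congr 1
    funext s
    rw [Subsingleton.elim s 0]

/-- Inflation to a sufficiently deep level is zero in degrees at least two. -/
theorem IsFreeProEll.transition_eq_zero (hL : IsFreeProEll ℓ L x) (hℓ : ℓ.Prime) {a : ℕ}
    (hV : Nat.card V = ℓ ^ a) (i : ℕ) {j k : ℕ} (hj : n₀ ≤ j) (hjk : j ≤ k)
    (hk : Nat.card V ^ Nat.card (EllQuotient ℓ L j) ^ (i + 1) * Nat.card (EllQuotient ℓ L j) ≤ k) :
    transition (cohomologySystem ρ (i + 2)) hj hjk = 0 := by
  ext c
  obtain ⟨f, hf, rfl⟩ := exists_eq_cocycleClass ρ hj c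
  rw [transition_cocycleClass]
  refine (cocycleClass_succ_eq_zero_iff ρ _ _).2 ?_
  obtain ⟨u, hu⟩ := hL.exists_coboundary_eq hℓ hjk i (inflatedRep ρ hj) hV hk f hf
  exact ⟨u, (inflatedRep_comp ρ hj hjk) ▸ hu⟩

end System

/-! ### Computable bounds -/

theorem primrec_natPow : Primrec₂ ((· ^ ·) : ℕ → ℕ → ℕ) :=
  Primrec₂.unpaired'.1 Nat.Primrec.pow

theorem primrec_ellBound : Primrec fun t : (ℕ × ℕ) × ℕ => ellBound t.1.1 t.1.2 t.2 := by
  have h : Primrec₂ fun (p : ℕ × ℕ) (n : ℕ) => (Nat.rec 1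
      (fun _ b => b * p.1 ^ (p.2 * b)) n : ℕ) := by
    have hb : Primrec fun q : (ℕ × ℕ) × ℕ × ℕ => q.2.2 := Primrec.snd.comp Primrec.snd
    have hs : Primrec₂ fun (p : ℕ × ℕ) (q : ℕ × ℕ) => q.2 * p.1 ^ (p.2 * q.2) :=
      Primrec.nat_mul.comp hb (primrec_natPow.comp (Primrec.fst.comp Primrec.fst)
        (Primrec.nat_mul.comp (Primrec.snd.comp Primrec.fst) hb))
    exact Primrec.nat_rec (Primrec.const 1) hs
  refine Primrec.of_eq h fun t => ?_
  obtain ⟨⟨ℓ, d⟩, n⟩ := t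
  change (Nat.rec 1 (fun _ b => b * ℓ ^ (d * b)) n : ℕ) = ellBound ℓ d n
  induction n with
  | zero => rfl
  | succ n ih =>
    rw [ellBound, ← ih]

namespace ExplicitAction

theorem primrec_equivTuple : Primrec (fun c : ExplicitAction => equivTuple c) :=
  Primrec.of_equiv

theorem primrec_prime : Primrec ExplicitAction.prime :=
  (Primrec.fst.comp primrec_equivTuple).of_eq fun _ => rfl

theorem primrec_rank : Primrec ExplicitAction.rank :=
  (Primrec.fst.comp (Primrec.snd.comp primrec_equivTuple)).of_eq fun _ => rfl

theorem primrec_level : Primrec ExplicitAction.level :=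
  (Primrec.fst.comp (Primrec.snd.comp (Primrec.snd.comp primrec_equivTuple))).of_eq fun _ => rfl

theorem primrec_card : Primrec ExplicitAction.card :=
  (Primrec.fst.comp (Primrec.snd.comp (Primrec.snd.comp (Primrec.snd.comp
    primrec_equivTuple)))).of_eq fun _ => rfl

theorem primrec_gens : Primrec ExplicitAction.gens :=
  (Primrec.fst.comp (Primrec.snd.comp (Primrec.snd.comp (Primrec.snd.comp (Primrec.snd.comp
    (Primrec.snd.comp (Primrec.snd.comp primrec_equivTuple))))))).of_eq fun _ => rfl

/-- A bound for the order of `V`. -/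
def orderBound (c : ExplicitAction) : ℕ := c.card ^ c.gens

/-- A bound for the order of `L^(n)`. -/
def quotientBound (c : ExplicitAction) (n : ℕ) : ℕ := ellBound c.prime c.rank n

/-- A level from which on the cohomology in degrees `0` and `1` is constant. -/
def stableLevel (c : ExplicitAction) (_i : ℕ) : ℕ :=
  c.level + c.orderBound * c.quotientBound c.level

/-- A level at which the classes of level `j` and degree `i ≥ 2` vanish. -/
def vanishingLevel (c : ExplicitAction) (i j : ℕ) : ℕ :=
  j + c.orderBound ^ c.quotientBound j ^ i * c.quotientBound j

theorem primrec_orderBound : Primrec orderBound :=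
  primrec_natPow.comp primrec_card primrec_gens

theorem primrec_quotientBound : Primrec₂ quotientBound := by
  have h : Primrec fun t : ExplicitAction × ℕ => ((t.1.prime, t.1.rank), t.2) :=
    ((primrec_prime.comp Primrec.fst).pair (primrec_rank.comp Primrec.fst)).pair Primrec.snd
  exact (primrec_ellBound.comp h).of_eq fun _ => rfl

theorem primrec_stableLevel : Primrec₂ stableLevel :=
  (Primrec.nat_add.comp primrec_level (Primrec.nat_mul.comp primrec_orderBound
    (primrec_quotientBound.comp Primrec.id primrec_level))).comp Primrec.fst

theorem primrec_vanishingLevel :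
    Primrec fun t : ExplicitAction × ℕ × ℕ => t.1.vanishingLevel t.2.1 t.2.2 := by
  have hj : Primrec fun t : ExplicitAction × ℕ × ℕ => t.2.2 := Primrec.snd.comp Primrec.snd
  have hi : Primrec fun t : ExplicitAction × ℕ × ℕ => t.2.1 := Primrec.fst.comp Primrec.snd
  have hb : Primrec fun t : ExplicitAction × ℕ × ℕ => t.1.quotientBound t.2.2 :=
    primrec_quotientBound.comp Primrec.fst hj
  exact Primrec.nat_add.comp hj (Primrec.nat_mul.comp (primrec_natPow.comp
    (primrec_orderBound.comp Primrec.fst) (primrec_natPow.comp hb hi)) hb)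

/-- The order of the module described by an explicit action. -/
theorem Describes.card_dvd {c : ExplicitAction} {L : Type u} [Group L] [TopologicalSpace L]
    [IsTopologicalGroup L] {x : Fin c.rank → L} {Λ : Type u} [CommRing Λ] {V : Type u}
    [AddCommGroup V] [Module Λ V] {ρ : Representation Λ (EllQuotient c.prime L c.level) V}
    (h : c.Describes x ρ) : Nat.card V ∣ c.orderBound := by
  have e := AddSubgroup.card_dvd_of_surjective h.proj.toAddMonoidHom h.proj_surjective
  rwa [Nat.card_fun, Nat.card_congr h.num, Nat.card_fin, Nat.card_fin] at e

end ExplicitAction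

theorem proposition6p5 :
    ∃ (N : ExplicitAction → ℕ → ℕ) (φ : ExplicitAction → ℕ → ℕ → ℕ),
      Computable (fun t : ExplicitAction × ℕ => N t.1 t.2) ∧
      Computable (fun t : ExplicitAction × ℕ × ℕ => φ t.1 t.2.1 t.2.2) ∧
      ∀ (c : ExplicitAction) (i : ℕ), c.prime.Prime → 1 ≤ c.level →
      ∀ (L : Type u) [Group L] [TopologicalSpace L] [IsTopologicalGroup L]
        (x : Fin c.rank → L), IsFreeProEll c.prime L x →
      ∀ (Λ : Type u) [CommRing Λ], (∃ k : ℕ, Nat.card Λ = c.prime ^ k) →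
      ∀ (V : Type u) [AddCommGroup V] [Module Λ V]
        (ρ : Representation Λ (EllQuotient c.prime L c.level) V),
        Nonempty (c.Describes x ρ) →
        IsEssentiallyConstant (cohomologySystem ρ i) (N c i) (φ c i) := by
  refine ⟨ExplicitAction.stableLevel, ExplicitAction.vanishingLevel,
    ExplicitAction.primrec_stableLevel.to_comp, ExplicitAction.primrec_vanishingLevel.to_comp, ?_⟩
  rintro c i hℓ - L _ _ _ x hL Λ _ ⟨m, hm⟩ V _ _ ρ ⟨hc⟩
  have hcard : c.card = c.prime ^ m := by rw [← hm, Nat.card_congr hc.num, Nat.card_fin]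
  have hpow : c.orderBound = c.prime ^ (m * c.gens) := by
    rw [ExplicitAction.orderBound, hcard, pow_mul]
  have hpos : 0 < c.orderBound := hpow ▸ Nat.pow_pos hℓ.pos
  -- Divisibility, not just the inequality, is needed here: it makes `|V|` a power of `ℓ`.
  obtain ⟨a, -, ha⟩ := (Nat.dvd_prime_pow hℓ).1 (hpow ▸ hc.card_dvd)
  have hV : Nat.card V ≤ c.orderBound := Nat.le_of_dvd hpos hc.card_dvd
  have hG (n : ℕ) : Nat.card (EllQuotient c.prime L n) ≤ c.quotientBound n :=
    (hL.ellQuotient_finite hℓ n).2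
  have hB (n : ℕ) : 0 < c.quotientBound n := ellBound_pos hℓ.pos _ _
  match i with
  | 0 | 1 =>
    refine IsEssentiallyConstant.of_bijective _ (Nat.le_add_right _ _)
      (fun j => Nat.le_add_right _ _) (fun j k hj hjk => ker_transition_eq_bot ρ (by decide) hj hjk)
      fun j hj => hL.range_transition_eq_top ρ hℓ ha (by decide) _ hj ?_
    exact (Nat.mul_le_mul hV (hG _)).trans (Nat.le_add_left _ _)
  | i + 2 =>
    refine IsEssentiallyConstant.of_eq_zero _ (Nat.le_add_right _ _)
      (fun j => Nat.le_add_right _ _) fun j hj => hL.transition_eq_zero ρ hℓ ha i hj _ ?_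
    refine le_trans (Nat.mul_le_mul ?_ (hG j)) (Nat.le_add_left _ _)
    -- In degree `i + 2` the chosen level has exponent `i + 2` where `i + 1` would do; the excess is
    -- harmless because `quotientBound` is positive.
    refine (Nat.pow_le_pow_left hV _).trans (Nat.pow_le_pow_right hpos ?_)
    exact (Nat.pow_le_pow_left (hG j) _).trans (Nat.pow_le_pow_right (hB j) (Nat.le_succ _))
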